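/- All logarithms are to base 2. Let $G = C_5 \boxplus \mathbf 1$ be the graph with vertices $0,1,2,3,4,5$ and edges $12,23,34,45,51$ (a pentagon and an isolated vertex $0$). Two vertices are called distinguishable if they are different and not adjacent. The zero-error capacity of $G$ is $C_0(G)=\limsup_{L\to\infty}\frac1L\log\alpha(G^{\boxtimes L})$, where $\alpha$ is the independence number and $\boxtimes$ the strong product. For a discrete memoryless channel $W$ with finite output alphabet $\mathcal Y$, the channel graph has the inputs as vertices, two different inputs being adjacent if some output has positive probability under both, and $C_0(W)=\limsup_{L\to\infty}\frac1L\log N(W,L)$, where $N(W,L)$ is the maximal size of a set of input words of length $L$ such that every output word has positive probability under at most one of them. Let $\mathcal C=\{0,11,23,35,42,54\}$. A transmission state is a vector $z=(z_c)_{c\in\mathcal C}$ with $0\le z_c\le |c|-1$. Let $\rho$ be the succession rule $$\rho(z)=\begin{cases}\mathcal C & \text{if } z_c=0 \text{ for all } c\ne 0,\\ \{0\}\cup\{c\in\mathcal C : z_c\ne 0\} & \text{otherwise.}\end{cases}$$ Starting from $z=(0,\dots,0)$, the encoder chooses at each time step a word $w\in\rho(z)$, sends the $(z_w+1)$-th letter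 of $w$, and replaces $z_w$ by $z_w+1 \bmod |w|$. Let $\mathcal S_L$ be the set of sequences of length $L$ which can be sent in this way with $z=(0,\dots,0)$ after the last step. The transition graph has the transmission states as vertices and an edge from $z$ to $z'$ whenever $z'$ can be obtained from $z$ in one step. Then: 1. The intermingled code $(\mathcal C,\rho)$ is zero-error for $G$: for all $c\neq c'$ in $\mathcal C$ with $|c|\le|c'|$, the words $c$ and the prefix of $c'$ of length $|c|$ have distinguishable letters in some position; and for every $L$, any two different elements of $\mathcal S_L$ have distinguishable letters in some position. 2. The states reachable from $0=(0,\dots,0)$ are exactly the six states $0,e^2,\dots,e^6$, where $e^i$ has its $i$-th coordinate equal to $1$ and all others equal to $0$ (coordinates ordered as $0,11,23,35,42,54$). The adjacency matrix of the transition graph on these states is $$M=\begin{pmatrix}1&1&1&1&1&1\\1&1&0&0&0&0\\1&0&1&0&0&0\\1&0&0&1&0&0\\1&0&0&0&1&0\\1&0&0&0&0&1\end{pmatrix}.$$ Its characteristic polynomial is $(X-1-\sqrt5)(X-1+\sqrt5)(X-1)^4$, and its maximal eigenvalue is $1+\sqrt5$. 3. $\mathcal S_L$ is nonempty for all large $L$,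 and the asymptotic rate of the code is $\lim_{L\to\infty}\frac1L\log\#\mathcal S_L=\log(1+\sqrt5)$. 4. $C_0(G)=\log(1+\sqrt5)$, and $C_0(W)=\log(1+\sqrt5)$ for every discrete memoryless channel $W$ with channel graph $G$. Thus the code $(\mathcal C,\rho)$ achieves the zero-error capacity. -/

import Mathlib

open Filter Topology

/-! ## Zero-error communication over a graph -/

/-- The strong power `G ⊠ ⋯ ⊠ G` (`L` factors), a graph on the words of length `L`. -/
def SimpleGraph.strongPower {V : Type*} (G : SimpleGraph V) (L : ℕ) :
    SimpleGraph (Fin L → V) where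
  Adj x x' := x ≠ x' ∧ ∀ l, x l = x' l ∨ G.Adj (x l) (x' l)
  symm := ⟨fun _ _ h => ⟨h.1.symm, fun l => (h.2 l).imp Eq.symm fun a => a.symm⟩⟩
  loopless := ⟨fun _ h => h.1 rfl⟩

/-- The zero-error capacity of a channel graph, in bits per channel use:
`limsup (1/L) log₂ α(G^⊠L)`. -/
noncomputable def SimpleGraph.zeroErrorCapacity {V : Type*} (G : SimpleGraph V) : ℝ :=
  limsup (fun L : ℕ => Real.logb 2 ((G.strongPower L).indepNum : ℝ) / L) atTop

/-- Two vertices of a channel graph are distinguishable if they are neither adjacent nor equal. -/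
def SimpleGraph.Distinguishable {V : Type*} (G : SimpleGraph V) (x x' : V) : Prop :=
  x ≠ x' ∧ ¬ G.Adj x x'

/-- A discrete memoryless channel with input alphabet `X` and output alphabet `Y`. -/
structure DMC (X Y : Type*) [Fintype Y] where
  /-- transition probabilities -/
  W : X → Y → ℝ
  nonneg : ∀ x y, 0 ≤ W x y
  sum_eq_one : ∀ x, ∑ y, W x y = 1

namespace DMC

variable {X Y : Type*} [Fintype Y]

/-- The channel graph: two different inputs are adjacent if they share a possible output. -/
def channelGraph (ch : DMC X Y) : SimpleGraph X where
  Adj x x' := x ≠ x' ∧ ∃ y, 0 < ch.W x y ∧ 0 < ch.W x' y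
  symm := ⟨fun _ _ h => ⟨h.1.symm, h.2.imp fun _ a => ⟨a.2, a.1⟩⟩⟩
  loopless := ⟨fun _ h => h.1 rfl⟩

/-- A codebook for `L` channel uses is distinguishable if every output sequence has positive
probability under at most one of its words. -/
def IsDistinguishable (ch : DMC X Y) {L : ℕ} (N : Finset (Fin L → X)) : Prop :=
  ∀ y : Fin L → Y, ∀ x ∈ N, ∀ x' ∈ N,
    ∏ l, ch.W (x l) (y l) ≠ 0 → ∏ l, ch.W (x' l) (y l) ≠ 0 → x = x'

open Classical in
/-- The maximum number of distinguishable inputs for `L` channel uses. -/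
noncomputable def maxDistinguishable [Fintype X] (ch : DMC X Y) (L : ℕ) : ℕ :=
  (Finset.univ.filter fun N : Finset (Fin L → X) => ch.IsDistinguishable N).sup Finset.card

/-- The zero-error capacity of a channel, in bits per channel use. -/
noncomputable def zeroErrorCapacity [Fintype X] (ch : DMC X Y) : ℝ :=
  limsup (fun L : ℕ => Real.logb 2 (ch.maxDistinguishable L : ℝ) / L) atTop

end DMC

/-! ## Intermingled codes -/

/-- A transmission state records, for each generator word `c`, a position in `{0, …, |c| - 1}`. -/
abbrev TransmissionState {X : Type*} (C : Finset (List X)) : Type _ :=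
  (c : C) → Fin c.1.length

/-- A finite generator set of nonempty words together with a succession rule. -/
structure IntermingledCode (X : Type*) where
  generator : Finset (List X)
  length_pos : ∀ c ∈ generator, 0 < c.length
  /-- the succession rule -/
  rule : TransmissionState generator → Finset generator
  rule_nonempty : ∀ z, (rule z).Nonempty

namespace IntermingledCode

variable {X : Type*} [DecidableEq X]

/-- The initial state `(0, …, 0)`. -/
def init (K : IntermingledCode X) : TransmissionState K.generator :=
  fun c => ⟨0, K.length_pos c.1 c.2⟩

/-- The symbol sent when the word `w` is chosen in state `z`. -/
def symbol (K : IntermingledCode X) (z : TransmissionState K.generator) (w : K.generator) : X :=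
  w.1.get (z w)

/-- The state after the word `w` has been chosen in state `z`: `z_w` becomes `z_w + 1 mod |w|`. -/
def step (K : IntermingledCode X) (z : TransmissionState K.generator) (w : K.generator) :
    TransmissionState K.generator :=
  Function.update z w ⟨((z w).val + 1) % w.1.length, Nat.mod_lt _ (K.length_pos w.1 w.2)⟩

/-- `K.codewords L` is the set of sequences of length `L` that the encoder can send when it starts
in the state `(0, …, 0)` and is back in the state `(0, …, 0)` after `L` steps; `w l` is the word
chosen at step `l` and `z l` the state in which it is chosen. -/
def codewords (K : IntermingledCode X) (L : ℕ) : Set (Fin L → X) :=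
  {x | ∃ (z : ℕ → TransmissionState K.generator) (w : Fin L → K.generator),
    z 0 = K.init ∧
    (∀ l : Fin L, w l ∈ K.rule (z l) ∧ x l = K.symbol (z l) (w l) ∧
      z (l + 1) = K.step (z l) (w l)) ∧
    z L = K.init}

/-- The generator set is zero-error: at the end of its transmission, a word `c` is distinguishable
from every other word `c'` that is at least as long. -/
def GeneratorIsZeroError (K : IntermingledCode X) (G : SimpleGraph X) : Prop :=
  ∀ c ∈ K.generator, ∀ c' ∈ K.generator, c ≠ c' → ∀ h : c.length ≤ c'.length,
    ∃ i : Fin c.length, G.Distinguishable (c.get i) (c'.get (i.castLE h))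

/-- The code is zero-error: different codewords of the same length are distinguishable at some
time step. -/
def IsZeroError (K : IntermingledCode X) (G : SimpleGraph X) : Prop :=
  ∀ L, ∀ x ∈ K.codewords L, ∀ x' ∈ K.codewords L, x ≠ x' → ∃ l, G.Distinguishable (x l) (x' l)

/-- `r` is the asymptotic rate `lim (1/L) log₂ #S_L`, where `S_L` is the set of codewords of
length `L`; the logarithms are required to be finite from some `L` on. -/
def HasAsymptoticRate (K : IntermingledCode X) (r : ℝ) : Prop :=
  (∀ᶠ L in atTop, (K.codewords L).Nonempty) ∧
  Tendsto (fun L : ℕ => Real.logb 2 ((K.codewords L).ncard : ℝ) / L) atTop (𝓝 r)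

/-- The transition graph on all transmission states. -/
def transitionGraph (K : IntermingledCode X) : Digraph (TransmissionState K.generator) where
  Adj v v' := ∃ w ∈ K.rule v, v' = K.step v w

/-- The states which the encoder can reach from `(0, …, 0)`. -/
def reachable (K : IntermingledCode X) : Set (TransmissionState K.generator) :=
  {v | Relation.ReflTransGen K.transitionGraph.Adj K.init v}

end IntermingledCode

/-! ## The channel graph `C₅ ⊞ 1` and the code -/

namespace PentagonPlusPoint

/-- The input alphabet. The vertices `1, 2, 3, 4, 5` of the pentagon are `inl 1, …, inl 5` (numerals
in `Fin 5`, so `inl 5 = inl 0`), the isolated vertex `0` is `inr 0`. -/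
abbrev Alphabet : Type := Fin 5 ⊕ Fin 1

/-- The channel graph `C₅ ⊞ 1`. -/
abbrev graph : SimpleGraph Alphabet := SimpleGraph.cycleGraph 5 ⊕g (⊥ : SimpleGraph (Fin 1))

open Sum in
/-- The words `0, 11, 23, 35, 42, 54`. -/
def word : Fin 6 → List Alphabet :=
  ![[inr 0], [inl 1, inl 1], [inl 2, inl 3], [inl 3, inl 5], [inl 4, inl 2], [inl 5, inl 4]]

/-- The generator set `{0, 11, 23, 35, 42, 54}`. -/
def words : Finset (List Alphabet) := Finset.univ.image word

/-- The succession rule: any word may be chosen if `z_c = 0` for all `c ≠ 0`; otherwise the word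
`0` may be chosen, or a word `c` with `z_c ≠ 0`. -/
def rule (z : TransmissionState words) : Finset words :=
  if ∀ c : words, c.1 ≠ word 0 → (z c).val = 0 then Finset.univ
  else Finset.univ.filter fun c => c.1 = word 0 ∨ (z c).val ≠ 0

/-- The intermingled code. -/
def code : IntermingledCode Alphabet where
  generator := words
  length_pos := by decide
  rule := rule
  rule_nonempty z := by
    have h0 : word 0 ∈ words := Finset.mem_image_of_mem _ (Finset.mem_univ _)
    refine ⟨⟨word 0, h0⟩, ?_⟩
    unfold rule
    split_ifs
    · exact Finset.mem_univ _
    · exact Finset.mem_filter.2 ⟨Finset.mem_univ _, Or.inl rfl⟩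

/-- The states `0, e², e³, e⁴, e⁵, e⁶`, where `eⁱ` is the `i`-th canonical basis vector (the
coordinates being ordered as in `word`). -/
def state (i : Fin 6) : TransmissionState code.generator :=
  fun c => ⟨if i ≠ 0 ∧ c.1 = word i then 1 else 0, by
    revert i c; decide⟩

/-- The explicit transition matrix on these states. -/
def transitionMatrix : Matrix (Fin 6) (Fin 6) ℝ :=
  !![1, 1, 1, 1, 1, 1;
     1, 1, 0, 0, 0, 0;
     1, 0, 1, 0, 0, 0;
     1, 0, 0, 1, 0, 0;
     1, 0, 0, 0, 1, 0;
     1, 0, 0, 0, 0, 1]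

end PentagonPlusPoint

/-! With `r = 1 + √5`, everything follows from `r ^ (L - 1) ≤ #S_L ≤ α(G^⊠L) ≤ r ^ L`. The right
bound is Lovász's: the pentagon's umbrella, with a fourth orthogonal direction for the isolated
vertex, has a handle of squared norm `√5 + 1` (`indepNum_strongPower_le`). The middle one says that
the code is zero-error. Run two encoders in parallel: until distinguishable letters are sent, either
they have behaved identically or each has one word pending, the two words being different with
indistinguishable first letters. They cannot both end in the initial state without resolving this
(`exists_distinguishable`). For the left bound, the letter sent determines the chosen word in each
reachable state, so codewords correspond to closed walks at `0`, whose number is bounded below by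
means of the Perron eigenvector of the transition matrix (`pow_le_of_recursion`). -/

/-! ### Independent sets of strong powers and Lovász's bound -/

theorem SimpleGraph.isIndepSet_strongPower_iff {V : Type*} (G : SimpleGraph V) {L : ℕ}
    (s : Set (Fin L → V)) :
    (G.strongPower L).IsIndepSet s ↔
      ∀ x ∈ s, ∀ x' ∈ s, x ≠ x' → ∃ l, G.Distinguishable (x l) (x' l) := by
  constructor
  · intro h x hx x' hx' hne
    by_contra! hcon
    refine h hx hx' hne ⟨hne, fun l => ?_⟩
    by_contra! hl
    exact hcon l ⟨hl.1, hl.2⟩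
  · intro h x hx x' hx' hne hadj
    obtain ⟨l, hl⟩ := h x hx x' hx' hne
    exact (hadj.2 l).elim hl.1 hl.2

/-- Lovász's bound: if distinguishable vertices carry orthogonal unit vectors, all of them having
inner product `1` with a vector `c`, then an independent set of the `L`-th strong power has at most
`‖c‖ ^ (2 * L)` elements. -/
theorem SimpleGraph.card_le_of_orthonormal_representation {V ι : Type*} [Fintype ι]
    (G : SimpleGraph V) (u : V → ι → ℝ) (c : ι → ℝ)
    (unit : ∀ v, ∑ i, u v i * u v i = 1)
    (orth : ∀ v w, G.Distinguishable v w → ∑ i, u v i * u w i = 0)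
    (handle : ∀ v, ∑ i, u v i * c i = 1) {L : ℕ} {s : Finset (Fin L → V)}
    (hs : (G.strongPower L).IsIndepSet s) :
    (s.card : ℝ) ≤ (∑ i, c i * c i) ^ L := by
  classical
  let T : (Fin L → ι → ℝ) → EuclideanSpace ℝ (Fin L → ι) :=
    fun f => WithLp.toLp 2 fun j => ∏ l, f l (j l)
  have inner_T (f g : Fin L → ι → ℝ) : inner ℝ (T f) (T g) = ∏ l, ∑ i, f l i * g l i := by
    rw [Finset.prod_univ_sum, PiLp.inner_apply]
    simp [T, Finset.prod_mul_distrib, mul_comm]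
  rw [SimpleGraph.isIndepSet_strongPower_iff] at hs
  -- Inner products of tensor products factor, so one distinguishable position suffices for
  -- orthogonality.
  have ortho : Orthonormal ℝ (fun x : s => T fun l => u (x.1 l)) := by
    rw [orthonormal_iff_ite]
    intro x x'
    rw [inner_T]
    split_ifs with h
    · subst h
      exact Finset.prod_eq_one fun l _ => unit _
    · obtain ⟨l, hl⟩ := hs x x.2 x' x'.2 fun h' => h (Subtype.ext h')
      exact Finset.prod_eq_zero (Finset.mem_univ l) (orth _ _ hl)
  -- Each inner product with the tensor power of `c` is `1`, so the left side of Bessel's inequality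
  -- counts `s`.
  have bessel := ortho.sum_inner_products_le (T fun _ => c) (s := Finset.univ)
  rw [← real_inner_self_eq_norm_sq, inner_T] at bessel
  simpa [inner_T, handle] using bessel

/-! ### From channels to their graphs -/

theorem DMC.isDistinguishable_iff {X Y : Type*} [Fintype Y] (ch : DMC X Y) {L : ℕ}
    (N : Finset (Fin L → X)) :
    ch.IsDistinguishable N ↔ (ch.channelGraph.strongPower L).IsIndepSet N := by
  constructor
  · intro h x hx x' hx' hne hadj
    have shared (l : Fin L) : ∃ y, 0 < ch.W (x l) y ∧ 0 < ch.W (x' l) y := by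
      rcases hadj.2 l with heq | hadj
      -- Equal letters share an output because probabilities sum to `1`, so some output is possible.
      · have hpos : 0 < ∑ y, ch.W (x l) y := by simp [ch.sum_eq_one]
        obtain ⟨y, -, hy⟩ := Finset.exists_lt_of_sum_lt (s := Finset.univ)
          (f := fun _ : Y => (0 : ℝ)) (g := ch.W (x l)) (by simpa using hpos)
        exact ⟨y, hy, heq ▸ hy⟩
      · exact hadj.2
    choose y hy hy' using shared
    exact hne (h y x hx x' hx' (Finset.prod_pos fun l _ => hy l).ne'
      (Finset.prod_pos fun l _ => hy' l).ne')
  · intro h y x hx x' hx' hy hy'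
    by_contra hne
    refine h hx hx' hne ⟨hne, fun l => or_iff_not_imp_left.2 fun hl => ⟨hl, y l, ?_, ?_⟩⟩
    · exact (ch.nonneg _ _).lt_of_ne' (Finset.prod_ne_zero_iff.1 hy l (Finset.mem_univ l))
    · exact (ch.nonneg _ _).lt_of_ne' (Finset.prod_ne_zero_iff.1 hy' l (Finset.mem_univ l))

theorem DMC.maxDistinguishable_eq {X Y : Type*} [Fintype X] [Fintype Y] (ch : DMC X Y) (L : ℕ) :
    ch.maxDistinguishable L = (ch.channelGraph.strongPower L).indepNum := by
  classical
  apply le_antisymm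
  · refine Finset.sup_le fun N hN => ?_
    exact ((ch.isDistinguishable_iff N).1 (Finset.mem_filter.1 hN).2).card_le_indepNum
  · obtain ⟨s, hs⟩ := (ch.channelGraph.strongPower L).exists_isNIndepSet_indepNum
    rw [← hs.card_eq]
    exact Finset.le_sup (f := Finset.card)
      (Finset.mem_filter.2 ⟨Finset.mem_univ _, (ch.isDistinguishable_iff s).2 hs.isIndepSet⟩)

theorem DMC.zeroErrorCapacity_eq {X Y : Type*} [Fintype X] [Fintype Y] (ch : DMC X Y) :
    ch.zeroErrorCapacity = ch.channelGraph.zeroErrorCapacity := by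
  simp only [DMC.zeroErrorCapacity, SimpleGraph.zeroErrorCapacity, ch.maxDistinguishable_eq]

/-! ### Growth rates -/

/-- The constant factor `r` costs only `logb 2 r / L`, which vanishes in the limit. Used both for
the code and for the independence numbers. -/
theorem tendsto_logb_div_of_pow_bounds {f : ℕ → ℕ} {r : ℝ} (hr : 1 < r)
    (lower : ∀ L, r ^ L ≤ r * f L) (upper : ∀ L, (f L : ℝ) ≤ r ^ L) :
    Tendsto (fun L : ℕ => Real.logb 2 (f L) / L) atTop (𝓝 (Real.logb 2 r)) := by
  have r0 : 0 < r := by linarith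
  have fpos (L : ℕ) : (0 : ℝ) < f L :=
    (mul_pos_iff_of_pos_left r0).1 ((pow_pos r0 L).trans_le (lower L))
  have lim : Tendsto (fun L : ℕ => Real.logb 2 r - Real.logb 2 r / L) atTop
      (𝓝 (Real.logb 2 r)) := by
    simpa using tendsto_const_nhds.sub
      (tendsto_const_div_atTop_nhds_zero_nat (Real.logb 2 r))
  refine tendsto_of_tendsto_of_tendsto_of_le_of_le' lim tendsto_const_nhds ?_ ?_
  · filter_upwards [eventually_gt_atTop 0] with L hL
    have hL' : (0 : ℝ) < L := by exact_mod_cast hL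
    have h := Real.logb_le_logb_of_le one_lt_two (pow_pos r0 L) (lower L)
    rw [Real.logb_pow, Real.logb_mul r0.ne' (fpos L).ne'] at h
    rw [le_div_iff₀ hL', sub_mul, div_mul_cancel₀ _ hL'.ne']
    linarith
  · filter_upwards [eventually_gt_atTop 0] with L hL
    have hL' : (0 : ℝ) < L := by exact_mod_cast hL
    have h := Real.logb_le_logb_of_le one_lt_two (fpos L) (upper L)
    rw [Real.logb_pow] at h
    rw [div_le_iff₀ hL']
    linarith

/-! ### Recursion on the first step of the encoder -/

namespace IntermingledCode

variable {X : Type*} [DecidableEq X]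

/-- The sequences of length `L` that can be sent from the state `v`, ending in `(0, …, 0)`. -/
def codewordsFrom (K : IntermingledCode X) (v : TransmissionState K.generator) (L : ℕ) :
    Set (Fin L → X) :=
  {x | ∃ (z : ℕ → TransmissionState K.generator) (w : Fin L → K.generator),
    z 0 = v ∧
    (∀ l : Fin L, w l ∈ K.rule (z l) ∧ x l = K.symbol (z l) (w l) ∧
      z (l + 1) = K.step (z l) (w l)) ∧
    z L = K.init}

theorem codewords_eq (K : IntermingledCode X) (L : ℕ) :
    K.codewords L = K.codewordsFrom K.init L := rfl

theorem mem_codewordsFrom_zero (K : IntermingledCode X) {v : TransmissionState K.generator}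
    {x : Fin 0 → X} : x ∈ K.codewordsFrom v 0 ↔ v = K.init := by
  constructor
  · rintro ⟨z, w, h0, -, hL⟩
    exact h0.symm.trans hL
  · intro h
    exact ⟨fun _ => v, Fin.elim0, rfl, fun l => l.elim0, h⟩

theorem mem_codewordsFrom_succ (K : IntermingledCode X) {v : TransmissionState K.generator}
    {L : ℕ} {x : Fin (L + 1) → X} :
    x ∈ K.codewordsFrom v (L + 1) ↔
      ∃ w ∈ K.rule v, x 0 = K.symbol v w ∧ Fin.tail x ∈ K.codewordsFrom (K.step v w) L := by
  constructor
  · rintro ⟨z, w, rfl, h, hL⟩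
    obtain ⟨h1, h2, h3⟩ := h 0
    refine ⟨w 0, h1, h2, fun n => z (n + 1), fun l => w l.succ, h3, fun l => ?_, hL⟩
    exact h l.succ
  · rintro ⟨w₀, h1, h2, z, w, h0, h, hL⟩
    refine ⟨fun n => n.casesOn v z, Fin.cons w₀ w, rfl, fun l => ?_, hL⟩
    refine Fin.cases ?_ (fun l => ?_) l
    · exact ⟨h1, h2, h0⟩
    · exact h l

theorem codewordsFrom_succ (K : IntermingledCode X) (v : TransmissionState K.generator) (L : ℕ) :
    K.codewordsFrom v (L + 1) =
      ⋃ w ∈ K.rule v, Fin.cons (α := fun _ => X) (K.symbol v w) ''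
        K.codewordsFrom (K.step v w) L := by
  ext x
  simp only [mem_codewordsFrom_succ, Set.mem_iUnion, Set.mem_image, exists_prop]
  refine exists_congr fun w => and_congr_right fun _ => ⟨fun h => ⟨_, h.2, ?_⟩, ?_⟩
  · rw [← h.1, Fin.cons_self_tail]
  · rintro ⟨y, hy, rfl⟩
    exact ⟨Fin.cons_zero _ _, by rwa [Fin.tail_cons]⟩

/-- By `inj` the first letter reveals the chosen word, so the union over first choices is disjoint.
-/
theorem ncard_codewordsFrom_succ [Finite X] (K : IntermingledCode X)
    (v : TransmissionState K.generator) (L : ℕ) (inj : Set.InjOn (K.symbol v) (K.rule v)) :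
    (K.codewordsFrom v (L + 1)).ncard =
      ∑ w ∈ K.rule v, (K.codewordsFrom (K.step v w) L).ncard := by
  classical
  have := Fintype.ofFinite X
  have himage (w : K.generator) : (Fin.cons (α := fun _ => X) (K.symbol v w) ''
      K.codewordsFrom (K.step v w) L).ncard = (K.codewordsFrom (K.step v w) L).ncard :=
    Set.ncard_image_of_injective _ (Fin.cons_right_injective _)
  simp only [codewordsFrom_succ, ← himage]
  rw [← finsum_mem_coe_finset, ← Set.Finite.ncard_biUnion (Finset.finite_toSet _)
    (fun _ _ => Set.toFinite _)]
  · rfl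
  · intro w hw w' hw' hne
    refine Set.disjoint_left.2 ?_
    rintro _ ⟨y, -, rfl⟩ ⟨y', -, h⟩
    exact hne (inj hw hw' (Fin.cons_inj.1 h).1.symm)

theorem IsZeroError.ncard_codewords_le_indepNum [Finite X] {K : IntermingledCode X}
    {G : SimpleGraph X} (h : K.IsZeroError G) (L : ℕ) :
    (K.codewords L).ncard ≤ (G.strongPower L).indepNum := by
  classical
  have := Fintype.ofFinite X
  rw [Set.ncard_eq_toFinset_card']
  apply SimpleGraph.IsIndepSet.card_le_indepNum
  rw [Set.coe_toFinset, SimpleGraph.isIndepSet_strongPower_iff]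
  exact h L

end IntermingledCode

/-! ### Spectrum of the transition matrix -/

namespace PentagonPlusPoint

set_option maxHeartbeats 2000000 in
open Polynomial in
theorem charpoly_transitionMatrix :
    transitionMatrix.charpoly = (X - C (1 + √5)) * (X - C (1 - √5)) * (X - C 1) ^ 4 := by
  have h5 : (C (√5) : ℝ[X]) * C (√5) = 5 := by
    rw [← C_mul, Real.mul_self_sqrt (by norm_num)]; rfl
  rw [Matrix.charpoly]
  simp [transitionMatrix, Matrix.charmatrix_apply, Matrix.det_succ_row_zero, Fin.sum_univ_succ,
    Fin.succAbove, Matrix.submatrix]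
  linear_combination (X - 1) ^ 4 * h5

theorem isGreatest_spectrum_transitionMatrix :
    IsGreatest (spectrum ℝ transitionMatrix) (1 + √5) := by
  have h0 := Real.sqrt_nonneg 5
  constructor
  · simp [Matrix.mem_spectrum_iff_isRoot_charpoly, charpoly_transitionMatrix]
  · intro r hr
    rw [Matrix.mem_spectrum_iff_isRoot_charpoly, charpoly_transitionMatrix] at hr
    simp only [Polynomial.IsRoot.def, Polynomial.eval_mul, Polynomial.eval_pow,
      Polynomial.eval_sub, Polynomial.eval_X, Polynomial.eval_C, mul_eq_zero, pow_eq_zero_iff,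
      ne_eq, OfNat.ofNat_ne_zero, not_false_eq_true] at hr
    rcases hr with (h | h) | h <;> linarith

/-! ### The six reachable states, indexed by `Fin 6` -/

/-- The generator word with index `i`. -/
def gen (i : Fin 6) : code.generator :=
  ⟨word i, Finset.mem_image_of_mem _ (Finset.mem_univ _)⟩

theorem gen_injective : Function.Injective gen := by decide

theorem gen_surjective : Function.Surjective gen := by
  rintro ⟨c, hc⟩
  obtain ⟨i, -, rfl⟩ := Finset.mem_image.1 hc
  exact ⟨i, rfl⟩

theorem exists_mem_rule_iff {v : TransmissionState code.generator} {p : code.generator → Prop} :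
    (∃ w ∈ code.rule v, p w) ↔ ∃ k, gen k ∈ code.rule v ∧ p (gen k) :=
  gen_surjective.exists

/-- The words that may be chosen in the state with index `i`. -/
def allowed (i : Fin 6) : Finset (Fin 6) := if i = 0 then Finset.univ else {0, i}

/-- The index of the state after the word with index `k` has been chosen in the state with
index `i`. -/
def next (i k : Fin 6) : Fin 6 := if i = 0 then k else if k = 0 then i else 0

/-- The letter sent when the word with index `k` is chosen in the state with index `i`. -/
def letter (i k : Fin 6) : Alphabet := code.symbol (state i) (gen k)

theorem state_zero : state 0 = code.init := by decide

theorem state_injective : Function.Injective state := by decide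

theorem gen_mem_rule_iff : ∀ i k : Fin 6, gen k ∈ code.rule (state i) ↔ k ∈ allowed i := by
  decide

theorem step_state :
    ∀ i : Fin 6, ∀ k ∈ allowed i, code.step (state i) (gen k) = state (next i k) := by
  decide

theorem rule_state (i : Fin 6) : code.rule (state i) = (allowed i).image gen := by
  ext w
  obtain ⟨k, rfl⟩ := gen_surjective w
  simp [gen_mem_rule_iff, gen_injective.eq_iff]

theorem adj_state_iff (i : Fin 6) (v : TransmissionState code.generator) :
    code.transitionGraph.Adj (state i) v ↔ ∃ k ∈ allowed i, v = state (next i k) := by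
  refine exists_mem_rule_iff.trans (exists_congr fun k => ?_)
  rw [gen_mem_rule_iff]
  exact and_congr_right fun hk => by rw [step_state i k hk]

theorem adj_state_state_iff (i j : Fin 6) :
    code.transitionGraph.Adj (state i) (state j) ↔ ∃ k ∈ allowed i, j = next i k := by
  simp only [adj_state_iff, state_injective.eq_iff]

theorem adj_state_state_iff' (i j : Fin 6) :
    code.transitionGraph.Adj (state i) (state j) ↔ i = 0 ∨ j = 0 ∨ i = j := by
  rw [adj_state_state_iff]
  revert i j
  decide

theorem transitionMatrix_apply (i j : Fin 6) :
    transitionMatrix i j = if i = 0 ∨ j = 0 ∨ i = j then 1 else 0 := by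
  fin_cases i <;> fin_cases j <;> simp [transitionMatrix]

theorem reachable_eq : code.reachable = Set.range state := by
  ext v
  constructor
  · intro h
    induction h with
    | refl => exact ⟨0, state_zero⟩
    | tail _ hadj ih =>
      obtain ⟨i, rfl⟩ := ih
      obtain ⟨k, -, rfl⟩ := (adj_state_iff i _).1 hadj
      exact ⟨_, rfl⟩
  · rintro ⟨i, rfl⟩
    rw [IntermingledCode.reachable, ← state_zero]
    exact .single ((adj_state_state_iff' 0 i).2 (Or.inl rfl))

/-! ### The code is zero-error -/

instance : DecidableRel graph.Distinguishable
  | .inl i, .inl j =>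
    decidable_of_iff (i ≠ j ∧ ¬ (SimpleGraph.cycleGraph 5).Adj i j)
      (and_congr_left' Sum.inl_injective.ne_iff.symm)
  | .inl _, .inr _ => .isTrue ⟨Sum.inl_ne_inr, by simp⟩
  | .inr _, .inl _ => .isTrue ⟨Sum.inr_ne_inl, by simp⟩
  | .inr _, .inr _ => .isFalse fun h => h.1 (congrArg Sum.inr (Subsingleton.elim _ _))

theorem generatorIsZeroError : code.GeneratorIsZeroError graph := by
  have h : ∀ c ∈ words, ∀ c' ∈ words, c ≠ c' → ∀ h : c.length ≤ c'.length,
      ∃ i : Fin c.length, graph.Distinguishable (c.get i) (c'.get (i.castLE h)) := by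
    decide
  exact h

theorem mem_codewordsFrom_state_succ {i : Fin 6} {L : ℕ} {x : Fin (L + 1) → Alphabet} :
    x ∈ code.codewordsFrom (state i) (L + 1) ↔
      ∃ k ∈ allowed i, x 0 = letter i k ∧
        Fin.tail x ∈ code.codewordsFrom (state (next i k)) L := by
  refine (code.mem_codewordsFrom_succ.trans exists_mem_rule_iff).trans
    (exists_congr fun k => ?_)
  rw [gen_mem_rule_iff]
  exact and_congr_right fun hk => by rw [step_state i k hk]; rfl

set_option synthInstance.maxSize 1000 in
set_option synthInstance.maxHeartbeats 200000 in
/-- In each transition step from two states which are equal, or in which two different words with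
indistinguishable first letters have been started, either distinguishable letters are sent or the
next two states are again of this kind. -/
theorem letter_dichotomy : ∀ i j : Fin 6,
    (i = j ∨ i ≠ 0 ∧ j ≠ 0 ∧ ¬ graph.Distinguishable (letter 0 i) (letter 0 j)) →
    ∀ k ∈ allowed i, ∀ k' ∈ allowed j,
      graph.Distinguishable (letter i k) (letter j k') ∨
      (i = j ∧ letter i k = letter j k' ∧ next i k = next j k') ∨
      (next i k ≠ next j k' ∧ next i k ≠ 0 ∧ next j k' ≠ 0 ∧
        ¬ graph.Distinguishable (letter 0 (next i k)) (letter 0 (next j k'))) := by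
  decide

/-- With different words pending, sending `0` on both sides changes nothing, sending it on one side
only is distinguishable from a pentagon letter, and completing both words gives distinguishable
second letters. -/
theorem exists_distinguishable {L : ℕ} : ∀ {i j : Fin 6} {x x' : Fin L → Alphabet},
    (i = j ∧ x ≠ x' ∨
      i ≠ j ∧ i ≠ 0 ∧ j ≠ 0 ∧ ¬ graph.Distinguishable (letter 0 i) (letter 0 j)) →
    x ∈ code.codewordsFrom (state i) L → x' ∈ code.codewordsFrom (state j) L →
    ∃ l, graph.Distinguishable (x l) (x' l) := by
  induction L with
  | zero =>
    intro i j x x' h hx hx'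
    rw [IntermingledCode.mem_codewordsFrom_zero, ← state_zero] at hx
    rcases h with h | h
    · exact (h.2 (Subsingleton.elim _ _)).elim
    -- A word still pending contradicts the return to the initial state.
    · exact (h.2.1 (state_injective hx)).elim
  | succ L ih =>
    intro i j x x' h hx hx'
    obtain ⟨k, hk, hk0, hkt⟩ := mem_codewordsFrom_state_succ.1 hx
    obtain ⟨k', hk', hk0', hkt'⟩ := mem_codewordsFrom_state_succ.1 hx'
    rcases letter_dichotomy i j (h.imp And.left And.right) k hk k' hk' with hd | ⟨rfl, hl, hn⟩ | hn
    · exact ⟨0, by rwa [hk0, hk0']⟩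
    · have hne : Fin.tail x ≠ Fin.tail x' := by
        intro ht
        have hxx : x ≠ x' := by tauto
        apply hxx
        rw [← Fin.cons_self_tail x, ← Fin.cons_self_tail x', ht, hk0, hk0', hl]
      obtain ⟨l, hl⟩ := ih (Or.inl ⟨hn, hne⟩) hkt hkt'
      exact ⟨l.succ, hl⟩
    · obtain ⟨l, hl⟩ := ih (Or.inr hn) hkt hkt'
      exact ⟨l.succ, hl⟩

theorem isZeroError : code.IsZeroError graph := by
  intro L x hx x' hx' hne
  rw [IntermingledCode.codewords_eq, ← state_zero] at hx hx'
  exact exists_distinguishable (Or.inl ⟨rfl, hne⟩) hx hx'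

/-! ### Counting codewords as walks -/

theorem symbol_injOn (i : Fin 6) :
    Set.InjOn (code.symbol (state i)) (code.rule (state i)) := by
  have h : ∀ i, ∀ k ∈ allowed i, ∀ k' ∈ allowed i, letter i k = letter i k' → k = k' := by
    decide
  intro w hw w' hw' heq
  obtain ⟨k, rfl⟩ := gen_surjective w
  obtain ⟨k', rfl⟩ := gen_surjective w'
  exact congrArg gen
    (h i k ((gen_mem_rule_iff i k).1 hw) k' ((gen_mem_rule_iff i k').1 hw') heq)

theorem ncard_codewordsFrom_state_succ (i : Fin 6) (L : ℕ) :
    (code.codewordsFrom (state i) (L + 1)).ncard =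
      ∑ k ∈ allowed i, (code.codewordsFrom (state (next i k)) L).ncard := by
  rw [code.ncard_codewordsFrom_succ _ _ (symbol_injOn i), rule_state,
    Finset.sum_image gen_injective.injOn]
  exact Finset.sum_congr rfl fun k hk => by rw [step_state i k hk]

theorem ncard_codewordsFrom_state_zero_succ (L : ℕ) :
    (code.codewordsFrom (state 0) (L + 1)).ncard =
      ∑ k, (code.codewordsFrom (state k) L).ncard :=
  ncard_codewordsFrom_state_succ 0 L

theorem ncard_codewordsFrom_state_succ_of_ne_zero {i : Fin 6} (hi : i ≠ 0) (L : ℕ) :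
    (code.codewordsFrom (state i) (L + 1)).ncard =
      (code.codewordsFrom (state 0) L).ncard + (code.codewordsFrom (state i) L).ncard := by
  rw [ncard_codewordsFrom_state_succ, allowed, if_neg hi, Finset.sum_pair hi.symm, add_comm]
  simp [next, hi]

theorem ncard_codewordsFrom_init_zero : (code.codewordsFrom (state 0) 0).ncard = 1 := by
  rw [Set.ncard_eq_one]
  refine ⟨Fin.elim0, Set.eq_singleton_iff_unique_mem.2
    ⟨code.mem_codewordsFrom_zero.2 state_zero, fun _ _ => Subsingleton.elim _ _⟩⟩

/-- A lower bound for the number of walks, from its recursion. -/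
theorem pow_le_of_recursion {N : ℕ → Fin 6 → ℝ} (nonneg : ∀ L i, 0 ≤ N L i) (base : N 0 0 = 1)
    (zero_succ : ∀ L, N (L + 1) 0 = ∑ k, N L k)
    (succ : ∀ L, ∀ i ≠ 0, N (L + 1) i = N L 0 + N L i) (L : ℕ) :
    (1 + √5) ^ L ≤ N (L + 1) 0 ∧ ∀ i ≠ 0, (1 + √5) ^ L ≤ √5 * N (L + 1) i := by
  have h5 : √5 * √5 = 5 := Real.mul_self_sqrt (by norm_num)
  have h1 : 1 ≤ √5 := Real.one_le_sqrt.2 (by norm_num)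
  -- The vector `(√5, 1, 1, 1, 1, 1)` is an eigenvector for `1 + √5`; the claim is that the counts
  -- at `L + 1` dominate `(1 + √5) ^ L / √5` times it. The shift by one is needed because the counts
  -- at `0` may vanish off the initial state.
  induction L with
  | zero =>
    constructor
    · rw [zero_succ, pow_zero, ← base]
      exact Finset.single_le_sum (fun i _ => nonneg 0 i) (Finset.mem_univ 0)
    · intro i hi
      rw [succ 0 i hi, base, pow_zero]
      exact one_le_mul_of_one_le_of_one_le h1 (le_add_of_nonneg_right (nonneg 0 i))
  | succ L ih =>
    obtain ⟨ih0, ih⟩ := ih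
    constructor
    · have hsum := Finset.sum_le_sum fun (i : Fin 5) (_ : i ∈ Finset.univ) =>
        ih i.succ i.succ_ne_zero
      rw [← Finset.mul_sum, Finset.sum_const, Finset.card_univ, Fintype.card_fin,
        nsmul_eq_mul, Nat.cast_ofNat] at hsum
      have hsum' : √5 * (1 + √5) ^ L ≤ ∑ i : Fin 5, N (L + 1) i.succ := by
        refine le_of_mul_le_mul_left ?_ (zero_lt_one.trans_le h1)
        rwa [← mul_assoc, h5]
      rw [zero_succ (L + 1), Fin.sum_univ_succ, pow_succ]
      linarith
    · intro i hi
      have h := mul_le_mul_of_nonneg_left ih0 (Real.sqrt_nonneg 5)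
      rw [succ (L + 1) i hi, pow_succ]
      linarith [ih i hi]

theorem pow_le_ncard_codewordsFrom (L : ℕ) :
    (1 + √5) ^ L ≤ ((code.codewordsFrom (state 0) (L + 1)).ncard : ℝ) := by
  refine (pow_le_of_recursion (N := fun L i => ((code.codewordsFrom (state i) L).ncard : ℝ))
    (fun _ _ => Nat.cast_nonneg _) ?_ (fun L => ?_) (fun L i hi => ?_) L).1
  · exact_mod_cast ncard_codewordsFrom_init_zero
  · exact_mod_cast ncard_codewordsFrom_state_zero_succ L
  · exact_mod_cast ncard_codewordsFrom_state_succ_of_ne_zero hi L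

theorem pow_le_ncard_codewords (L : ℕ) :
    (1 + √5) ^ L ≤ (1 + √5) * (code.codewords L).ncard := by
  rw [IntermingledCode.codewords_eq, ← state_zero]
  cases L with
  | zero => simp [ncard_codewordsFrom_init_zero]
  | succ L =>
    rw [pow_succ']
    exact mul_le_mul_of_nonneg_left (pow_le_ncard_codewordsFrom L) (by positivity)

/-! ### The umbrella and the upper bound -/

/-- Lovász's umbrella for the pentagon, and an orthogonal vector for the isolated vertex. -/
noncomputable def umbrella : Alphabet → Fin 4 → ℝ :=
  Sum.elim
    (fun i => ![√(√5)⁻¹, √(1 - (√5)⁻¹) * Real.cos (i.val * (2 * Real.pi / 5)),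
      √(1 - (√5)⁻¹) * Real.sin (i.val * (2 * Real.pi / 5)), 0])
    (fun _ => ![0, 0, 0, 1])

theorem umbrella_inner_inl (i j : Fin 5) :
    ∑ a, umbrella (.inl i) a * umbrella (.inl j) a =
      (√5)⁻¹ + (1 - (√5)⁻¹) * Real.cos (((i.val : ℝ) - j.val) * (2 * Real.pi / 5)) := by
  have h1 : (√5)⁻¹ ≤ 1 := inv_le_one_of_one_le₀ (Real.one_le_sqrt.2 (by norm_num))
  have hs : √(√5)⁻¹ * √(√5)⁻¹ = (√5)⁻¹ := Real.mul_self_sqrt (by positivity)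
  have ht : √(1 - (√5)⁻¹) * √(1 - (√5)⁻¹) = 1 - (√5)⁻¹ := Real.mul_self_sqrt (by linarith)
  rw [sub_mul (i.val : ℝ), Real.cos_sub]
  simp only [umbrella, Sum.elim_inl, Fin.sum_univ_four, Matrix.cons_val]
  linear_combination hs + (Real.cos (i.val * (2 * Real.pi / 5)) *
    Real.cos (j.val * (2 * Real.pi / 5)) + Real.sin (i.val * (2 * Real.pi / 5)) *
    Real.sin (j.val * (2 * Real.pi / 5))) * ht

theorem cos_two_mul_two_pi_div_five : Real.cos (2 * (2 * Real.pi / 5)) = -((1 + √5) / 4) := by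
  rw [← Real.cos_pi_div_five, ← Real.cos_pi_sub]
  congr 1
  ring

theorem cos_three_mul_two_pi_div_five : Real.cos (3 * (2 * Real.pi / 5)) = -((1 + √5) / 4) := by
  rw [← Real.cos_pi_div_five, ← Real.cos_add_pi]
  congr 1
  ring

/-- Non-adjacent ribs are `4π/5` apart up to sign and full turns. The squared height `1/√5` is
chosen to cancel the resulting cosine: `1/√5 = (1 - 1/√5) (1 + √5) / 4`. -/
theorem umbrella_orthogonal (v w : Alphabet) (h : graph.Distinguishable v w) :
    ∑ a, umbrella v a * umbrella w a = 0 := by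
  have key (i j : Fin 5) (hcos : Real.cos (((i.val : ℝ) - j.val) * (2 * Real.pi / 5)) =
      -((1 + √5) / 4)) : ∑ a, umbrella (.inl i) a * umbrella (.inl j) a = 0 := by
    have h5 : √5 * √5 = 5 := Real.mul_self_sqrt (by norm_num)
    have h0 : √5 ≠ 0 := by positivity
    rw [umbrella_inner_inl, hcos]
    field_simp
    linear_combination -h5
  rcases v with i | i <;> rcases w with j | j
  · have hd : ∀ i j : Fin 5, graph.Distinguishable (.inl i) (.inl j) →
        i.val = j.val + 2 ∨ i.val = j.val + 3 ∨ j.val = i.val + 2 ∨ j.val = i.val + 3 := by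
      decide
    apply key
    rcases hd i j h with h | h | h | h
    · rw [h, Nat.cast_add, add_sub_cancel_left]
      exact cos_two_mul_two_pi_div_five
    · rw [h, Nat.cast_add, add_sub_cancel_left]
      exact cos_three_mul_two_pi_div_five
    · rw [h, Nat.cast_add, sub_add_cancel_left, neg_mul, Real.cos_neg]
      exact cos_two_mul_two_pi_div_five
    · rw [h, Nat.cast_add, sub_add_cancel_left, neg_mul, Real.cos_neg]
      exact cos_three_mul_two_pi_div_five
  · simp [umbrella, Fin.sum_univ_four]
  · simp [umbrella, Fin.sum_univ_four]
  · exact (h.1 (congrArg Sum.inr (Subsingleton.elim i j))).elim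

theorem indepNum_strongPower_le (L : ℕ) :
    ((graph.strongPower L).indepNum : ℝ) ≤ (1 + √5) ^ L := by
  obtain ⟨s, hs⟩ := (graph.strongPower L).exists_isNIndepSet_indepNum
  have h0 : √(√5) ≠ 0 := by positivity
  -- The entry `√(√5)` is the inverse of the umbrella's height, making the inner products `1`; the
  -- squared norm is `√5 + 1`.
  have h := graph.card_le_of_orthonormal_representation umbrella ![√(√5), 0, 0, 1] ?_
    umbrella_orthogonal ?_ hs.isIndepSet
  · rw [hs.card_eq] at h
    simpa [Fin.sum_univ_four, add_comm] using h
  · rintro (i | i)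
    · simp [umbrella_inner_inl]
    · simp [umbrella, Fin.sum_univ_four]
  · rintro (i | i)
    · simp [umbrella, Fin.sum_univ_four, h0]
    · simp [umbrella, Fin.sum_univ_four]

/-! ### Rate and capacity -/

theorem ncard_codewords_le_indepNum (L : ℕ) :
    ((code.codewords L).ncard : ℝ) ≤ (graph.strongPower L).indepNum :=
  Nat.cast_le.2 (isZeroError.ncard_codewords_le_indepNum L)

theorem one_lt_one_add_sqrt_five : 1 < 1 + √5 := by
  have : 0 < √5 := by positivity
  linarith

theorem hasAsymptoticRate : code.HasAsymptoticRate (Real.logb 2 (1 + √5)) := by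
  constructor
  · refine Eventually.of_forall fun L => Set.nonempty_of_ncard_ne_zero fun h => ?_
    have hle := pow_le_ncard_codewords L
    rw [h, Nat.cast_zero, mul_zero] at hle
    exact hle.not_gt (by positivity)
  · exact tendsto_logb_div_of_pow_bounds one_lt_one_add_sqrt_five pow_le_ncard_codewords
      fun L => (ncard_codewords_le_indepNum L).trans (indepNum_strongPower_le L)

theorem zeroErrorCapacity_graph : graph.zeroErrorCapacity = Real.logb 2 (1 + √5) := by
  refine (tendsto_logb_div_of_pow_bounds one_lt_one_add_sqrt_five (fun L => ?_)
    indepNum_strongPower_le).limsup_eq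
  exact (pow_le_ncard_codewords L).trans
    (mul_le_mul_of_nonneg_left (ncard_codewords_le_indepNum L) (by positivity))

end PentagonPlusPoint

open PentagonPlusPoint Polynomial in
theorem proposition3 :
    -- the generator set and the code are zero-error
    code.GeneratorIsZeroError graph ∧ code.IsZeroError graph ∧
    -- the explicit matrix is the adjacency matrix of the transition graph on the reachable states
    Function.Injective state ∧ code.reachable = Set.range state ∧
    (∀ i j, (code.transitionGraph.Adj (state i) (state j) → transitionMatrix i j = 1) ∧
      (¬ code.transitionGraph.Adj (state i) (state j) → transitionMatrix i j = 0)) ∧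
    -- its characteristic polynomial and its maximal eigenvalue
    transitionMatrix.charpoly =
      (X - C (1 + √5)) * (X - C (1 - √5)) * (X - C 1) ^ 4 ∧
    IsGreatest (spectrum ℝ transitionMatrix) (1 + √5) ∧
    -- the rate of the code
    code.HasAsymptoticRate (Real.logb 2 (1 + √5)) ∧
    -- the zero-error capacity of the channel graph, and of every channel with this channel graph
    graph.zeroErrorCapacity = Real.logb 2 (1 + √5) ∧
    (∀ (Y : Type*) [Fintype Y] (ch : DMC Alphabet Y), ch.channelGraph = graph →
      ch.zeroErrorCapacity = Real.logb 2 (1 + √5)) := by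
  refine ⟨generatorIsZeroError, isZeroError, state_injective, reachable_eq, fun i j => ?_,
    charpoly_transitionMatrix, isGreatest_spectrum_transitionMatrix, hasAsymptoticRate,
    zeroErrorCapacity_graph, fun Y _ ch hch => ?_⟩
  · rw [transitionMatrix_apply, adj_state_state_iff']
    exact ⟨fun h => if_pos h, fun h => if_neg h⟩
  · rw [ch.zeroErrorCapacity_eq, hch, zeroErrorCapacity_graph]
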